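/- Let $\langle A,B\rangle=\mathrm{tr}(A^*B)$ and $\|A\|_F=\sqrt{\mathrm{tr}(A^*A)}$ on $\mathbb{C}^{n\times p}$, and let $\mathrm{St}(n,p)=\{X\in\mathbb{C}^{n\times p}: X^*X=I_p\}$. Let $f:\mathbb{C}^{n\times p}\to\mathbb{R}$ be $\mathbb{R}$-differentiable, with Euclidean gradient $\nabla f(X)$ defined by $Df(X)[V]=\Re\langle\nabla f(X),V\rangle$, and with Riemannian gradient $\mathrm{grad}\, f(X)=\nabla f(X)-X\,\mathrm{sym}(X^*\nabla f(X))$ at $X\in\mathrm{St}(n,p)$, where $\mathrm{sym}(A)=(A+A^*)/2$. Fix parameters $0<\eta_1\le\eta_2<1$ and $0<\gamma_0<1<\gamma_1\le\gamma_2$, and let $d(X,Y)$ be either $\|X-Y\|_F^2$ (quadratic regularization) or $\tfrac23\|X-Y\|_F^3$ (cubic regularization). Let $X^k\in\mathrm{St}(n,p)$ (iterates), $Z^k\in\mathrm{St}(n,p)$ (trial points), $\tau_k>0$ (regularization parameters) and real-linear operators $\mathcal{B}^k:\mathbb{C}^{n\times p}\to\mathbb{C}^{n\times p}$, $k=0,1,2,\dots$,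 be generated by the structured quasi-Newton method without subspace refinement. That is, with $$m_k(X)=\Re\langle\nabla f(X^k),X-X^k\rangle+\tfrac12\Re\langle\mathcal{B}^k[X-X^k],X-X^k\rangle+\tfrac{\tau_k}{2}d(X,X^k),\qquad r_k=\frac{f(Z^k)-f(X^k)}{m_k(Z^k)},$$ for every $k$ with $\mathrm{grad}\, f(X^k)\ne0$: $X^{k+1}=Z^k$ if $r_k\ge\eta_1$ and $X^{k+1}=X^k$ otherwise; and $\tau_{k+1}\in(0,\gamma_0\tau_k]$ if $r_k\ge\eta_2$, $\tau_{k+1}\in[\tau_k,\gamma_1\tau_k]$ if $\eta_1\le r_k<\eta_2$, and $\tau_{k+1}\in[\gamma_1\tau_k,\gamma_2\tau_k]$ if $r_k<\eta_1$. (If $\mathrm{grad}\, f(X^k)=0$, the method may stop, and $X^{k+1}\in\mathrm{St}(n,p)$, $\tau_{k+1}>0$ are arbitrary.) Assume: (A1) there is $L_f>0$ with $\|\nabla f(X)-\nabla f(Y)\|_F\le L_f\|X-Y\|_F$ for all $X,Y$ in the convex hull of $\mathrm{St}(n,p)$; (A2) there is $\kappa_H>0$ such that the operator norm of $\mathcal{B}^k$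 induced by $\|\cdot\|_F$ satisfies $\|\mathcal{B}^k\|\le\kappa_H$ for all $k$; (inexactness) there is $c>0$ with $m_k(Z^k)\le -c\,\|\mathrm{grad}\, f(X^k)\|_F^2$ for all $k$ with $\mathrm{grad}\, f(X^k)\neq 0$. Then either $\mathrm{grad}\, f(X^t)=0$ for some $t>0$, or $\lim_{k\to\infty}\|\mathrm{grad}\, f(X^k)\|_F=0$. -/

import Mathlib

open Filter Topology
open scoped Matrix

/- Complex matrices carry the Frobenius norm `‖A‖ = sqrt (tr (Aᴴ A))`. -/
attribute [local instance] Matrix.frobeniusNormedAddCommGroup Matrix.frobeniusNormedSpace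

noncomputable section

namespace StructQN

/-- The complex Stiefel manifold `{X | Xᴴ X = I}`. -/
def stiefel (n p : ℕ) : Set (Matrix (Fin n) (Fin p) ℂ) := {X | Xᴴ * X = 1}

/-- The real part `Re tr (Aᴴ B)` of the Frobenius inner product. -/
def reInner {n p : ℕ} (A B : Matrix (Fin n) (Fin p) ℂ) : ℝ := (Matrix.trace (Aᴴ * B)).re

/-- The Euclidean gradient of a real-valued function of a complex matrix: its `(i, j)` entry is
`∂f/∂(Re X i j) + I * ∂f/∂(Im X i j)`, so that it represents the real derivative of `f` with
respect to `reInner` (see `fderiv_eq_reInner_egrad`). -/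
def egrad {n p : ℕ} (f : Matrix (Fin n) (Fin p) ℂ → ℝ) (X : Matrix (Fin n) (Fin p) ℂ) :
    Matrix (Fin n) (Fin p) ℂ :=
  Matrix.of fun i j =>
    ((fderiv ℝ f X (Matrix.single i j 1) : ℝ) : ℂ)
      + ((fderiv ℝ f X (Matrix.single i j Complex.I) : ℝ) : ℂ) * Complex.I

theorem fderiv_eq_reInner_egrad {n p : ℕ} (f : Matrix (Fin n) (Fin p) ℂ → ℝ)
    (X V : Matrix (Fin n) (Fin p) ℂ) : fderiv ℝ f X V = reInner (egrad f X) V := by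
  have hV : V = ∑ i, ∑ j, ((V i j).re • Matrix.single i j (1 : ℂ)
      + (V i j).im • Matrix.single i j Complex.I) := by
    conv_lhs => rw [Matrix.matrix_eq_sum_single V]
    refine Finset.sum_congr rfl fun i _ => Finset.sum_congr rfl fun j _ => ?_
    rw [Matrix.smul_single, Matrix.smul_single, ← Matrix.single_add]
    congr 1
    apply Complex.ext <;> simp
  conv_lhs => rw [hV]
  simp only [map_sum, map_add, map_smul, smul_eq_mul, reInner, Matrix.trace, Matrix.diag,
    Matrix.mul_apply, Matrix.conjTranspose_apply, egrad, Matrix.of_apply, Complex.re_sum]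
  rw [Finset.sum_comm]
  refine Finset.sum_congr rfl fun i _ => Finset.sum_congr rfl fun j _ => ?_
  simp [Complex.mul_re]
  ring

/-- The Hermitian part `sym A = (A + Aᴴ) / 2`. -/
def sym {p : ℕ} (A : Matrix (Fin p) (Fin p) ℂ) : Matrix (Fin p) (Fin p) ℂ :=
  (1 / 2 : ℂ) • (A + Aᴴ)

/-- `Proj_X Z = Z - X sym (Xᴴ Z)`, for `X` in the Stiefel manifold the orthogonal projection onto
the tangent space `{ξ | Xᴴ ξ + ξᴴ X = 0}`. -/
def proj {n p : ℕ} (X Z : Matrix (Fin n) (Fin p) ℂ) : Matrix (Fin n) (Fin p) ℂ :=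
  Z - X * sym (Xᴴ * Z)

/-- The Riemannian gradient of `f` on the Stiefel manifold (with the metric of the ambient
Euclidean space). -/
def rgrad {n p : ℕ} (f : Matrix (Fin n) (Fin p) ℂ → ℝ) (X : Matrix (Fin n) (Fin p) ℂ) :
    Matrix (Fin n) (Fin p) ℂ :=
  proj X (egrad f X)

/-- The two choices of the proximal term. -/
inductive Regularization where
  | quadratic
  | cubic

/-- The proximal term `d(X, Y)`: `‖X - Y‖²` or `(2/3) ‖X - Y‖³`. -/
def Regularization.dist {n p : ℕ} :
    Regularization → Matrix (Fin n) (Fin p) ℂ → Matrix (Fin n) (Fin p) ℂ → ℝ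
  | .quadratic, X, Y => ‖X - Y‖ ^ 2
  | .cubic, X, Y => 2 / 3 * ‖X - Y‖ ^ 3

/-- The subproblem objective at the current point `Xk`, with Hessian approximation `Bk` and
regularization parameter `τk` (`Bk` is real-linear, as is the Hessian of a real-differentiable `f`):
`Re⟨∇f(Xk), X - Xk⟩ + (1/2) Re⟨Bk[X - Xk], X - Xk⟩ + (τk/2) d(X, Xk)`. -/
def model {n p : ℕ} (reg : Regularization) (f : Matrix (Fin n) (Fin p) ℂ → ℝ)
    (Xk : Matrix (Fin n) (Fin p) ℂ)
    (Bk : Matrix (Fin n) (Fin p) ℂ →ₗ[ℝ] Matrix (Fin n) (Fin p) ℂ) (τk : ℝ)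
    (X : Matrix (Fin n) (Fin p) ℂ) : ℝ :=
  reInner (egrad f Xk) (X - Xk) + 1 / 2 * reInner (Bk (X - Xk)) (X - Xk)
    + τk / 2 * reg.dist X Xk

/-- Parameters of the algorithm. -/
structure Params where
  η₁ : ℝ
  η₂ : ℝ
  γ₀ : ℝ
  γ₁ : ℝ
  γ₂ : ℝ
  η₁_pos : 0 < η₁
  η₁_le_η₂ : η₁ ≤ η₂
  η₂_lt_one : η₂ < 1
  γ₀_pos : 0 < γ₀
  γ₀_lt_one : γ₀ < 1
  one_lt_γ₁ : 1 < γ₁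
  γ₁_le_γ₂ : γ₁ ≤ γ₂

/-- The ratio of the actual to the predicted reduction for the trial point `Zk`. -/
def ratio {n p : ℕ} (reg : Regularization) (f : Matrix (Fin n) (Fin p) ℂ → ℝ)
    (Xk : Matrix (Fin n) (Fin p) ℂ)
    (Bk : Matrix (Fin n) (Fin p) ℂ →ₗ[ℝ] Matrix (Fin n) (Fin p) ℂ) (τk : ℝ)
    (Zk : Matrix (Fin n) (Fin p) ℂ) : ℝ :=
  (f Zk - f Xk) / model reg f Xk Bk τk Zk

/-- `X` (iterates), `τ` (regularization parameters), `B` (Hessian approximations) and `Z` (trial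
points) form a run of the structured quasi-Newton method without subspace refinement. The update
rules are imposed as long as the current iterate is not stationary. At a stationary point the ratio
may be undefined and the method may stop, so nothing is asked of the next iterate except that it is
feasible; a run that stops there is continued arbitrarily, for example constantly. -/
structure IsRun {n p : ℕ} (reg : Regularization) (P : Params)
    (f : Matrix (Fin n) (Fin p) ℂ → ℝ)
    (X : ℕ → Matrix (Fin n) (Fin p) ℂ) (τ : ℕ → ℝ)
    (B : ℕ → (Matrix (Fin n) (Fin p) ℂ →ₗ[ℝ] Matrix (Fin n) (Fin p) ℂ))
    (Z : ℕ → Matrix (Fin n) (Fin p) ℂ) : Prop where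
  X_mem : ∀ k, X k ∈ stiefel n p
  Z_mem : ∀ k, Z k ∈ stiefel n p
  τ_pos : ∀ k, 0 < τ k
  accept : ∀ k, rgrad f (X k) ≠ 0 →
    P.η₁ ≤ ratio reg f (X k) (B k) (τ k) (Z k) → X (k + 1) = Z k
  reject : ∀ k, rgrad f (X k) ≠ 0 →
    ratio reg f (X k) (B k) (τ k) (Z k) < P.η₁ → X (k + 1) = X k
  τ_very_successful : ∀ k, rgrad f (X k) ≠ 0 →
    P.η₂ ≤ ratio reg f (X k) (B k) (τ k) (Z k) → τ (k + 1) ∈ Set.Ioc 0 (P.γ₀ * τ k)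
  τ_successful : ∀ k, rgrad f (X k) ≠ 0 →
    P.η₁ ≤ ratio reg f (X k) (B k) (τ k) (Z k) →
    ratio reg f (X k) (B k) (τ k) (Z k) < P.η₂ → τ (k + 1) ∈ Set.Icc (τ k) (P.γ₁ * τ k)
  τ_unsuccessful : ∀ k, rgrad f (X k) ≠ 0 →
    ratio reg f (X k) (B k) (τ k) (Z k) < P.η₁ →
    τ (k + 1) ∈ Set.Icc (P.γ₁ * τ k) (P.γ₂ * τ k)

end StructQN

end

/-!
Fix `ε > 0` and call an iteration successful when its ratio is at least `η₁`. Three facts force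
`‖grad f (X k)‖ < ε` for all large `k`, provided no iterate is stationary.

* On the Stiefel manifold, `f (Z k) - f (X k)` exceeds the model value by at most
  `C * ‖Z k - X k‖ ^ 2 - τ k / 2 * d (Z k, X k)`, with `C` depending on the Lipschitz constant of
  the gradient and on the bound for `B k` (`sub_le_model_add`). For large `τ k` this excess is
  uniformly small (`Regularization.exists_error_le`), whereas the model value is at most
  `-c * ε ^ 2` when `‖grad f (X k)‖ ≥ ε`. Hence there is a threshold above which `τ k` makes such an
  iteration successful (`IsRun.exists_threshold`).
* A successful iteration with `‖grad f (X k)‖ ≥ ε` lowers `f` by at least `η₁ * c * ε ^ 2`. As `f` is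
  bounded below on the compact Stiefel manifold and `f (X k)` never increases, this happens only
  finitely often (`IsRun.eventually_sub_lt`).
* So if `‖grad f (X N)‖ ≥ ε` for some late `N`, iteration `N` is unsuccessful and `X (N + 1) = X N`,
  and inductively the iterates stay at `X N` while `τ` grows geometrically, past the threshold of
  the first fact: a contradiction.

Since an unsuccessful iteration does not move, this gives the full limit directly; continuity of the
Riemannian gradient along the run plays no role.
-/

open Filter Topology
open scoped Matrix

namespace StructQN

variable {n p : ℕ}

/-! ### The Frobenius inner product and the Stiefel manifold -/

theorem frobenius_norm_eq_sqrt (A : Matrix (Fin n) (Fin p) ℂ) :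
    ‖A‖ = √(∑ x : Fin n × Fin p, ‖A x.1 x.2‖ ^ 2) := by
  rw [Matrix.frobenius_norm_def, Real.sqrt_eq_rpow, Fintype.sum_prod_type]
  simp

theorem reInner_le_norm_mul_norm (A B : Matrix (Fin n) (Fin p) ℂ) :
    reInner A B ≤ ‖A‖ * ‖B‖ := by
  have h : reInner A B = ∑ x : Fin n × Fin p, (star (A x.1 x.2) * B x.1 x.2).re := by
    simp only [reInner, Matrix.trace, Matrix.diag, Matrix.mul_apply, Matrix.conjTranspose_apply,
      Complex.re_sum]
    rw [Finset.sum_comm, Fintype.sum_prod_type]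
  calc reInner A B ≤ ∑ x : Fin n × Fin p, ‖A x.1 x.2‖ * ‖B x.1 x.2‖ := by
        rw [h]
        refine Finset.sum_le_sum fun x _ => (Complex.re_le_norm _).trans ?_
        rw [norm_mul, norm_star]
    _ ≤ ‖A‖ * ‖B‖ := by
        rw [frobenius_norm_eq_sqrt, frobenius_norm_eq_sqrt]
        exact Real.sum_mul_le_sqrt_mul_sqrt _ _ _

theorem neg_norm_mul_norm_le_reInner (A B : Matrix (Fin n) (Fin p) ℂ) :
    -(‖A‖ * ‖B‖) ≤ reInner A B := by
  have h := reInner_le_norm_mul_norm (-A) B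
  have h' : reInner (-A) B = -reInner A B := by simp [reInner]
  rw [h', norm_neg] at h
  linarith

theorem reInner_sub_left (A A' B : Matrix (Fin n) (Fin p) ℂ) :
    reInner (A - A') B = reInner A B - reInner A' B := by
  simp [reInner, Matrix.sub_mul]

theorem reInner_self (A : Matrix (Fin n) (Fin p) ℂ) : reInner A A = ‖A‖ ^ 2 := by
  rw [frobenius_norm_eq_sqrt, Real.sq_sqrt (by positivity)]
  simp only [reInner, Matrix.trace, Matrix.diag, Matrix.mul_apply, Matrix.conjTranspose_apply,
    Complex.re_sum]
  rw [Finset.sum_comm, Fintype.sum_prod_type]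
  refine Finset.sum_congr rfl fun i _ => Finset.sum_congr rfl fun j _ => ?_
  rw [← Complex.normSq_eq_norm_sq, Complex.normSq_apply]
  simp

theorem isCompact_stiefel (n p : ℕ) : IsCompact (stiefel n p) := by
  have : ProperSpace (Matrix (Fin n) (Fin p) ℂ) := FiniteDimensional.proper ℝ _
  refine Metric.isCompact_of_isClosed_isBounded ?_ ?_
  · exact isClosed_eq
      (f := fun X : Matrix (Fin n) (Fin p) ℂ => Xᴴ * X) (g := fun _ => 1) (by fun_prop) (by fun_prop)
  · refine (Metric.isBounded_closedBall (x := 0) (r := √p)).subset fun X hX => ?_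
    have hX : Xᴴ * X = 1 := hX
    have h : ‖X‖ ^ 2 = p := by rw [← reInner_self, reInner, hX]; simp
    rw [mem_closedBall_zero_iff, ← h, Real.sqrt_sq (norm_nonneg X)]

/-! ### Actual and predicted change of the objective -/

/-- The mean value theorem on the segment joining `X` and `Y` bounds the first-order Taylor
remainder; the constant is twice the optimal one, which is immaterial here. -/
theorem sub_le_reInner_egrad_add {f : Matrix (Fin n) (Fin p) ℂ → ℝ} (hf : Differentiable ℝ f)
    {L : ℝ} (hL : 0 ≤ L) {s : Set (Matrix (Fin n) (Fin p) ℂ)} (hs : Convex ℝ s)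
    (hLip : ∀ X ∈ s, ∀ Y ∈ s, ‖egrad f X - egrad f Y‖ ≤ L * ‖X - Y‖)
    {X Y : Matrix (Fin n) (Fin p) ℂ} (hX : X ∈ s) (hY : Y ∈ s) :
    f Y - f X ≤ reInner (egrad f X) (Y - X) + L * ‖Y - X‖ ^ 2 := by
  obtain ⟨W, hW, hfW⟩ := domain_mvt (s := s)
    (fun x _ => (hf x).hasFDerivAt.hasFDerivWithinAt) hs hX hY
  have hWX : ‖W - X‖ ≤ ‖Y - X‖ := norm_sub_le_of_mem_segment hW
  have hle : ‖egrad f W - egrad f X‖ * ‖Y - X‖ ≤ L * ‖Y - X‖ * ‖Y - X‖ := by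
    gcongr
    exact (hLip W (hs.segment_subset hX hY hW) X hX).trans (by gcongr)
  have h := reInner_le_norm_mul_norm (egrad f W - egrad f X) (Y - X)
  rw [reInner_sub_left] at h
  have hfW' : f Y - f X = reInner (egrad f W) (Y - X) :=
    hfW.trans (fderiv_eq_reInner_egrad f W (Y - X))
  linarith

theorem sub_le_model_add (reg : Regularization) {f : Matrix (Fin n) (Fin p) ℂ → ℝ}
    (hf : Differentiable ℝ f) {L : ℝ} (hL : 0 ≤ L) {s : Set (Matrix (Fin n) (Fin p) ℂ)}
    (hs : Convex ℝ s)
    (hLip : ∀ X ∈ s, ∀ Y ∈ s, ‖egrad f X - egrad f Y‖ ≤ L * ‖X - Y‖)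
    {B : Matrix (Fin n) (Fin p) ℂ →ₗ[ℝ] Matrix (Fin n) (Fin p) ℂ} {κ : ℝ}
    (hB : ∀ V, ‖B V‖ ≤ κ * ‖V‖) (τ : ℝ)
    {X Z : Matrix (Fin n) (Fin p) ℂ} (hX : X ∈ s) (hZ : Z ∈ s) :
    f Z - f X ≤ model reg f X B τ Z + ((L + κ / 2) * ‖Z - X‖ ^ 2 - τ / 2 * reg.dist Z X) := by
  have h1 := sub_le_reInner_egrad_add hf hL hs hLip hX hZ
  have h2 := neg_norm_mul_norm_le_reInner (B (Z - X)) (Z - X)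
  have h3 : ‖B (Z - X)‖ * ‖Z - X‖ ≤ κ * ‖Z - X‖ * ‖Z - X‖ := by gcongr; exact hB _
  unfold model
  linarith

/-- For quadratic regularization the left-hand side is eventually nonpositive. For cubic
regularization it can stay positive for `X` close to `Y`, but only where it is small. -/
theorem Regularization.exists_error_le (reg : Regularization) {C δ : ℝ} (hC : 0 < C)
    (hδ : 0 < δ) :
    ∃ T : ℝ, ∀ τ, T ≤ τ → ∀ X Y : Matrix (Fin n) (Fin p) ℂ,
      C * ‖X - Y‖ ^ 2 - τ / 2 * reg.dist X Y ≤ δ := by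
  cases reg with
  | quadratic =>
    refine ⟨2 * C, fun τ hτ X Y => ?_⟩
    have h := mul_le_mul_of_nonneg_right hτ (sq_nonneg ‖X - Y‖)
    simp only [Regularization.dist]
    linarith
  | cubic =>
    -- Steps shorter than `√(δ / C)` cost at most `δ`; for longer ones the cubic term dominates.
    have hs : 0 < √(δ / C) := Real.sqrt_pos.2 (by positivity)
    have hT : 0 ≤ 3 * C / √(δ / C) := by positivity
    refine ⟨3 * C / √(δ / C), fun τ hτ X Y => ?_⟩
    simp only [Regularization.dist]
    have hτ0 : 0 ≤ τ := hT.trans hτ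
    rcases le_total ‖X - Y‖ √(δ / C) with h | h
    · have h1 : ‖X - Y‖ ^ 2 ≤ δ / C := (Real.le_sqrt (norm_nonneg _) (by positivity)).1 h
      rw [le_div_iff₀ hC] at h1
      have h2 : 0 ≤ τ * ‖X - Y‖ ^ 3 := by positivity
      linarith
    · have h1 : 3 * C ≤ τ * ‖X - Y‖ :=
        ((div_le_iff₀ hs).1 hτ).trans (by gcongr)
      have h2 := mul_le_mul_of_nonneg_right h1 (sq_nonneg ‖X - Y‖)
      linarith [show τ * ‖X - Y‖ * ‖X - Y‖ ^ 2 = τ * ‖X - Y‖ ^ 3 by ring]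

/-! ### Successful and unsuccessful iterations -/

section Run

variable {reg : Regularization} {P : Params} {f : Matrix (Fin n) (Fin p) ℂ → ℝ}
  {X : ℕ → Matrix (Fin n) (Fin p) ℂ} {τ : ℕ → ℝ}
  {B : ℕ → (Matrix (Fin n) (Fin p) ℂ →ₗ[ℝ] Matrix (Fin n) (Fin p) ℂ)}
  {Z : ℕ → Matrix (Fin n) (Fin p) ℂ} {c ε : ℝ}

/-- An iteration whose regularization parameter is large relative to the size of the Riemannian
gradient is successful. -/
theorem IsRun.exists_threshold (hrun : IsRun reg P f X τ B Z) (hf : Differentiable ℝ f)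
    {L : ℝ} (hL : 0 < L)
    (hLip : ∀ X ∈ convexHull ℝ (stiefel n p), ∀ Y ∈ convexHull ℝ (stiefel n p),
      ‖egrad f X - egrad f Y‖ ≤ L * ‖X - Y‖)
    {κ : ℝ} (hκ : 0 < κ) (hB : ∀ k V, ‖B k V‖ ≤ κ * ‖V‖) (hc : 0 < c)
    (hmodel : ∀ k, rgrad f (X k) ≠ 0 →
      model reg f (X k) (B k) (τ k) (Z k) ≤ -c * ‖rgrad f (X k)‖ ^ 2) (hε : 0 < ε) :
    ∃ T : ℝ, ∀ k, ε ≤ ‖rgrad f (X k)‖ → T ≤ τ k →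
      P.η₁ ≤ ratio reg f (X k) (B k) (τ k) (Z k) := by
  have hη : 0 < 1 - P.η₁ := by linarith [P.η₁_le_η₂, P.η₂_lt_one]
  -- An excess of `(1 - η₁) * (c * ε ^ 2)` over a model value `m ≤ -c * ε ^ 2` still leaves at
  -- most `η₁ * m`.
  obtain ⟨T, hT⟩ := reg.exists_error_le (n := n) (p := p) (C := L + κ / 2)
    (δ := (1 - P.η₁) * (c * ε ^ 2)) (by positivity) (by positivity)
  refine ⟨T, fun k hk hτ => ?_⟩
  have hm : model reg f (X k) (B k) (τ k) (Z k) ≤ -(c * ε ^ 2) := by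
    have h := hmodel k (norm_pos_iff.1 (hε.trans_le hk))
    have h' : c * ε ^ 2 ≤ c * ‖rgrad f (X k)‖ ^ 2 := by gcongr
    linarith
  have hm0 : model reg f (X k) (B k) (τ k) (Z k) < 0 :=
    hm.trans_lt (neg_lt_zero.2 (by positivity))
  have hdiff := sub_le_model_add reg hf hL.le (convex_convexHull ℝ _) hLip (hB k) (τ k)
    (subset_convexHull ℝ _ (hrun.X_mem k)) (subset_convexHull ℝ _ (hrun.Z_mem k))
  have herr := hT (τ k) hτ (Z k) (X k)
  have hmul := mul_le_mul_of_nonneg_left hm hη.le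
  rw [ratio, le_div_iff_of_neg hm0]
  linarith

theorem IsRun.mul_sq_le_sub (hrun : IsRun reg P f X τ B Z) (hc : 0 < c)
    (hmodel : ∀ k, rgrad f (X k) ≠ 0 →
      model reg f (X k) (B k) (τ k) (Z k) ≤ -c * ‖rgrad f (X k)‖ ^ 2)
    {k : ℕ} (hk : rgrad f (X k) ≠ 0) (hr : P.η₁ ≤ ratio reg f (X k) (B k) (τ k) (Z k)) :
    P.η₁ * (c * ‖rgrad f (X k)‖ ^ 2) ≤ f (X k) - f (X (k + 1)) := by
  have hpos : 0 < ‖rgrad f (X k)‖ := norm_pos_iff.2 hk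
  have hm0 : model reg f (X k) (B k) (τ k) (Z k) < 0 := by
    have h : 0 < c * ‖rgrad f (X k)‖ ^ 2 := by positivity
    linarith [hmodel k hk]
  rw [hrun.accept k hk hr]
  rw [ratio, le_div_iff_of_neg hm0] at hr
  have h := mul_le_mul_of_nonneg_left (hmodel k hk) P.η₁_pos.le
  linarith

theorem IsRun.apply_succ_le (hrun : IsRun reg P f X τ B Z) (hc : 0 < c)
    (hmodel : ∀ k, rgrad f (X k) ≠ 0 →
      model reg f (X k) (B k) (τ k) (Z k) ≤ -c * ‖rgrad f (X k)‖ ^ 2)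
    {k : ℕ} (hk : rgrad f (X k) ≠ 0) : f (X (k + 1)) ≤ f (X k) := by
  rcases le_or_gt P.η₁ (ratio reg f (X k) (B k) (τ k) (Z k)) with hr | hr
  · have h := hrun.mul_sq_le_sub hc hmodel hk hr
    have h' : 0 ≤ P.η₁ * (c * ‖rgrad f (X k)‖ ^ 2) :=
      mul_nonneg P.η₁_pos.le (by positivity)
    linarith
  · rw [hrun.reject k hk hr]

/-- The decrease of `f` per iteration tends to zero, because `f` is bounded below on the Stiefel
manifold. -/
theorem IsRun.eventually_sub_lt (hrun : IsRun reg P f X τ B Z) (hf : Continuous f) (hc : 0 < c)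
    (hmodel : ∀ k, rgrad f (X k) ≠ 0 →
      model reg f (X k) (B k) (τ k) (Z k) ≤ -c * ‖rgrad f (X k)‖ ^ 2)
    (hne : ∀ k, 0 < k → rgrad f (X k) ≠ 0) {δ : ℝ} (hδ : 0 < δ) :
    ∀ᶠ k in atTop, f (X k) - f (X (k + 1)) < δ := by
  -- The start may be stationary, and then `f (X 1)` may exceed `f (X 0)`.
  have hanti : Antitone fun k => f (X (k + 1)) :=
    antitone_nat_of_succ_le fun k => hrun.apply_succ_le hc hmodel (hne (k + 1) k.succ_pos)
  have hbdd : BddBelow (Set.range fun k => f (X (k + 1))) := by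
    refine ((isCompact_stiefel n p).bddBelow_image hf.continuousOn).mono ?_
    rintro _ ⟨k, rfl⟩
    exact ⟨X (k + 1), hrun.X_mem _, rfl⟩
  have hlim := (tendsto_add_atTop_iff_nat (f := fun k => f (X k)) 1).1
    (tendsto_atTop_ciInf hanti hbdd)
  have hsub := hlim.sub ((tendsto_add_atTop_iff_nat (f := fun k => f (X k)) 1).2 hlim)
  rw [sub_self] at hsub
  exact hsub.eventually_lt_const hδ

end Run

end StructQN

open StructQN in
theorem mainTheorem1 (n p : ℕ) (f : Matrix (Fin n) (Fin p) ℂ → ℝ)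
    (hf : Differentiable ℝ f)
    (hA1 : ∃ Lf : ℝ, 0 < Lf ∧
      ∀ X ∈ convexHull ℝ (StructQN.stiefel n p), ∀ Y ∈ convexHull ℝ (StructQN.stiefel n p),
        ‖StructQN.egrad f X - StructQN.egrad f Y‖ ≤ Lf * ‖X - Y‖)
    (reg : StructQN.Regularization) (P : StructQN.Params)
    (X : ℕ → Matrix (Fin n) (Fin p) ℂ) (τ : ℕ → ℝ)
    (B : ℕ → (Matrix (Fin n) (Fin p) ℂ →ₗ[ℝ] Matrix (Fin n) (Fin p) ℂ))
    (Z : ℕ → Matrix (Fin n) (Fin p) ℂ)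
    (hrun : StructQN.IsRun reg P f X τ B Z)
    (hA2 : ∃ κH : ℝ, 0 < κH ∧ ∀ k V, ‖B k V‖ ≤ κH * ‖V‖)
    (hinexact : ∃ c : ℝ, 0 < c ∧ ∀ k, StructQN.rgrad f (X k) ≠ 0 →
      StructQN.model reg f (X k) (B k) (τ k) (Z k) ≤ -c * ‖StructQN.rgrad f (X k)‖ ^ 2) :
    (∃ t : ℕ, 0 < t ∧ StructQN.rgrad f (X t) = 0) ∨
      Tendsto (fun k => ‖StructQN.rgrad f (X k)‖) atTop (𝓝 0) := by
  obtain ⟨L, hL, hLip⟩ := hA1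
  obtain ⟨κ, hκ, hB⟩ := hA2
  obtain ⟨c, hc, hmodel⟩ := hinexact
  by_cases hstat : ∃ t : ℕ, 0 < t ∧ rgrad f (X t) = 0
  · exact Or.inl hstat
  right
  have hne : ∀ k, 0 < k → rgrad f (X k) ≠ 0 := fun k hk h => hstat ⟨k, hk, h⟩
  rw [Metric.tendsto_atTop]
  intro ε hε
  obtain ⟨T, hT⟩ := hrun.exists_threshold hf hL hLip hκ hB hc hmodel hε
  have hη := P.η₁_pos
  obtain ⟨N₀, hN₀⟩ := eventually_atTop.1 (hrun.eventually_sub_lt hf.continuous hc hmodel hne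
    (δ := P.η₁ * (c * ε ^ 2)) (by positivity))
  refine ⟨N₀ + 1, fun N hN => ?_⟩
  rw [dist_zero_right, norm_norm]
  by_contra! hlarge
  have hunsucc : ∀ k, N ≤ k → ε ≤ ‖rgrad f (X k)‖ →
      ratio reg f (X k) (B k) (τ k) (Z k) < P.η₁ := by
    intro k hk hεk
    by_contra! hr
    have h1 := hrun.mul_sq_le_sub hc hmodel (hne k (by omega)) hr
    have h2 : P.η₁ * (c * ε ^ 2) ≤ P.η₁ * (c * ‖rgrad f (X k)‖ ^ 2) := by gcongr
    linarith [hN₀ k (by omega)]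
  have hstuck : ∀ j, X (N + j) = X N ∧ P.γ₁ ^ j * τ N ≤ τ (N + j) := by
    intro j
    induction j with
    | zero => simp
    | succ j ih =>
      have hr := hunsucc (N + j) (by omega) (by rw [ih.1]; exact hlarge)
      have hj := hne (N + j) (by omega)
      refine ⟨(hrun.reject _ hj hr).trans ih.1, ?_⟩
      have hγ : 0 ≤ P.γ₁ := by linarith [P.one_lt_γ₁]
      calc P.γ₁ ^ (j + 1) * τ N = P.γ₁ * (P.γ₁ ^ j * τ N) := by ring
        _ ≤ P.γ₁ * τ (N + j) := by gcongr; exact ih.2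
        _ ≤ τ (N + (j + 1)) := (hrun.τ_unsuccessful _ hj hr).1
  obtain ⟨j, hj⟩ := pow_unbounded_of_one_lt (T / τ N) P.one_lt_γ₁
  rw [div_lt_iff₀ (hrun.τ_pos N)] at hj
  have hεj : ε ≤ ‖rgrad f (X (N + j))‖ := by rw [(hstuck j).1]; exact hlarge
  exact (hunsucc (N + j) (by omega) hεj).not_ge (hT _ hεj (hj.le.trans (hstuck j).2))
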